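/- Let $k$ be a commutative ring with unit, let $A$ be an associative unital $k$-algebra, and write $\otimes$ for $\otimes_k$; on every (bi)module over a $k$-algebra, $k$ acts through the algebra, and centrally on bimodules. Let $\mathfrak C$ be an $A$-coring with coproduct $\Delta$, i.e. an $A$-bimodule with a coassociative $A$-bilinear coproduct $\Delta:\mathfrak C\to\mathfrak C\otimes_A\mathfrak C$ and an $A$-bilinear counit $\varepsilon:\mathfrak C\to A$. Let $M$ be a right $\mathfrak C$-comodule with coaction $m\mapsto\sum m_{(0)}\otimes m_{(1)}\in M\otimes_A\mathfrak C$ that is finitely generated and projective as a right $A$-module, and let $B=\mathrm{End}^{\mathfrak C}(M)$ be its ring of right $\mathfrak C$-colinear endomorphisms (product: composition), so that $M$ is a left $B$-module. Let $M^*=\mathrm{Hom}_A(M,A)$ be the right dual, with the left $\mathfrak C$-coaction $\xi\mapsto\sum_i\sum\xi(e^i{}_{(0)})e^i{}_{(1)}\otimes\xi^i\in\mathfrak C\otimes_A M^*$, where $\{e^i\in M,\xi^i\in M^*\}$ is any finite dual basis of $M$ (the coaction does not depend on it). View $M^*\otimes M$ as a left $\mathfrak C$-comodule through the coaction of $M^*$,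 and $\mathfrak C$ as a left and right $\mathfrak C$-comodule through $\Delta$. Suppose that: (a) $\mathfrak C$ is a flat left $A$-module; (b) $M$ is a projective $k$-module; (c) the map $$\widetilde{\mathrm{can}}_M: M^*\otimes M\to\mathfrak C,\qquad \xi\otimes m\mapsto\sum\xi(m_{(0)})m_{(1)},$$ is a split epimorphism of left $\mathfrak C$-comodules, i.e. it has a left $\mathfrak C$-colinear right inverse. Then $M$ is a principal comodule, that is: (i) $M$ is a Galois comodule: $M$ is finitely generated and projective as a right $A$-module, and the evaluation map $$\varphi_{\mathfrak C}:\mathrm{Hom}^{\mathfrak C}(M,\mathfrak C)\otimes_B M\to\mathfrak C,\qquad f\otimes m\mapsto f(m),$$ is an isomorphism of right $\mathfrak C$-comodules, where $B$ acts on the right $\mathfrak C$-colinear maps $f: M\to\mathfrak C$ by $fb=f\circ b$ and $\mathrm{Hom}^{\mathfrak C}(M,\mathfrak C)\otimes_B M$ has the coaction $f\otimes m\mapsto\sum f\otimes m_{(0)}\otimes m_{(1)}$; (ii) $M$ is projective as a left $B$-module. -/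

import Mathlib

open MulOpposite
open scoped TensorProduct

universe uk uA uC uM uN uP uR uS uX

/-! Conventions: `k` is a commutative ring and `A` a `k`-algebra. A right `A`-module is a
`Module Aᵐᵒᵖ M`, so `op a • m` is `m a`. All modules over a `k`-algebra carry the induced
`k`-module structure (`IsScalarTower k A N`, `IsScalarTower k Aᵐᵒᵖ M`). -/

/-- The tensor product `M ⊗_R N` of a right module `M` and a left module `N` over a `k`-algebra `R`:
the quotient of `M ⊗_k N` by the relations `m r ⊗ n = m ⊗ r n`. -/
def BalTensor (k : Type uk) (R : Type uR) (M : Type uM) (N : Type uN) [CommRing k] [Ring R]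
    [AddCommGroup M] [Module k M] [Module Rᵐᵒᵖ M] [AddCommGroup N] [Module k N] [Module R N] :
    Type (max uM uN) :=
  (M ⊗[k] N) ⧸ Submodule.span k
    {x : M ⊗[k] N | ∃ (m : M) (r : R) (n : N), x = (op r • m) ⊗ₜ[k] n - m ⊗ₜ[k] (r • n)}

namespace BalTensor

section Basic

variable {k : Type uk} {R : Type uR} {M : Type uM} {N : Type uN} {P : Type uP} [CommRing k] [Ring R]
  [AddCommGroup M] [Module k M] [Module Rᵐᵒᵖ M] [AddCommGroup N] [Module k N] [Module R N]
  [AddCommGroup P] [Module k P]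

noncomputable instance : AddCommGroup (BalTensor k R M N) :=
  inferInstanceAs (AddCommGroup ((M ⊗[k] N) ⧸ Submodule.span k _))

noncomputable instance instModuleBase : Module k (BalTensor k R M N) :=
  inferInstanceAs (Module k ((M ⊗[k] N) ⧸ Submodule.span k _))

variable (k R) in
/-- The pure tensor `m ⊗ n` in `M ⊗_R N`. -/
noncomputable def tmul (m : M) (n : N) : BalTensor k R M N :=
  Submodule.Quotient.mk (m ⊗ₜ[k] n)

theorem add_tmul (m m' : M) (n : N) : tmul k R (m + m') n = tmul k R m n + tmul k R m' n := by
  unfold tmul; rw [TensorProduct.add_tmul]; rfl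

theorem tmul_add (m : M) (n n' : N) : tmul k R m (n + n') = tmul k R m n + tmul k R m n' := by
  unfold tmul; rw [TensorProduct.tmul_add]; rfl

@[simp]
theorem zero_tmul (n : N) : tmul k R (0 : M) n = 0 := by
  unfold tmul; rw [TensorProduct.zero_tmul]; rfl

@[simp]
theorem tmul_zero (m : M) : tmul k R m (0 : N) = 0 := by
  unfold tmul; rw [TensorProduct.tmul_zero]; rfl

theorem smul_tmul' (c : k) (m : M) (n : N) : tmul k R (c • m) n = c • tmul k R m n := by
  unfold tmul; rw [← TensorProduct.smul_tmul']; rfl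

theorem tmul_smul' (c : k) (m : M) (n : N) : tmul k R m (c • n) = c • tmul k R m n := by
  unfold tmul; rw [TensorProduct.tmul_smul]; rfl

theorem op_smul_tmul (m : M) (r : R) (n : N) : tmul k R (op r • m) n = tmul k R m (r • n) :=
  (Submodule.Quotient.eq _).2 (Submodule.subset_span ⟨m, r, n, rfl⟩)

@[elab_as_elim]
theorem induction_on {p : BalTensor k R M N → Prop} (x : BalTensor k R M N)
    (zero : p 0) (tmul : ∀ m n, p (tmul k R m n)) (add : ∀ x y, p x → p y → p (x + y)) : p x := by
  obtain ⟨t, rfl⟩ := Submodule.Quotient.mk_surjective _ x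
  induction t using TensorProduct.induction_on with
  | zero => exact zero
  | tmul m n => exact tmul m n
  | add x y hx hy => exact add _ _ hx hy

/-- The map `M ⊗_R N → P` induced by a `k`-bilinear `R`-balanced map. -/
noncomputable def lift (f : M →ₗ[k] N →ₗ[k] P)
    (hf : ∀ (m : M) (r : R) (n : N), f (op r • m) n = f m (r • n)) : BalTensor k R M N →ₗ[k] P :=
  Submodule.liftQ _ (TensorProduct.lift f) (Submodule.span_le.2 (by
    rintro _ ⟨m, r, n, rfl⟩
    simp [hf]))

@[simp]
theorem lift_tmul (f : M →ₗ[k] N →ₗ[k] P) (hf) (m : M) (n : N) :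
    lift (R := R) f hf (tmul k R m n) = f m n := rfl

end Basic

section Map

variable {k : Type uk} {R : Type uR} {M : Type uM} {N : Type uN} [CommRing k] [Ring R] [Algebra k R]
  [AddCommGroup M] [Module k M] [Module Rᵐᵒᵖ M] [IsScalarTower k Rᵐᵒᵖ M]
  [AddCommGroup N] [Module k N] [Module R N] [IsScalarTower k R N]
  {M' : Type*} {N' : Type*}
  [AddCommGroup M'] [Module k M'] [Module Rᵐᵒᵖ M'] [IsScalarTower k Rᵐᵒᵖ M']
  [AddCommGroup N'] [Module k N'] [Module R N'] [IsScalarTower k R N']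

variable (k) in
/-- `f ⊗_R g`. -/
noncomputable def map (f : M →ₗ[Rᵐᵒᵖ] M') (g : N →ₗ[R] N') :
    BalTensor k R M N →ₗ[k] BalTensor k R M' N' :=
  lift
    (LinearMap.mk₂ k (fun m n => tmul k R (f m) (g n))
      (fun m m' n => by rw [map_add, add_tmul])
      (fun c m n => by rw [← smul_tmul', ← LinearMap.map_smul_of_tower])
      (fun m n n' => by rw [map_add, tmul_add])
      (fun c m n => by rw [← tmul_smul', ← LinearMap.map_smul_of_tower]))
    (fun m r n => by simp [op_smul_tmul])

@[simp]
theorem map_tmul (f : M →ₗ[Rᵐᵒᵖ] M') (g : N →ₗ[R] N') (m : M) (n : N) :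
    map k f g (tmul k R m n) = tmul k R (f m) (g n) := rfl

theorem map_add_left (f f' : M →ₗ[Rᵐᵒᵖ] M') (g : N →ₗ[R] N') (x : BalTensor k R M N) :
    map k (f + f') g x = map k f g x + map k f' g x := by
  induction x using induction_on with
  | zero => simp
  | tmul m n => simp [add_tmul]
  | add x y hx hy => simp only [map_add, hx, hy]; abel

theorem map_add_right (f : M →ₗ[Rᵐᵒᵖ] M') (g g' : N →ₗ[R] N') (x : BalTensor k R M N) :
    map k f (g + g') x = map k f g x + map k f g' x := by
  induction x using induction_on with
  | zero => simp
  | tmul m n => simp [tmul_add]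
  | add x y hx hy => simp only [map_add, hx, hy]; abel

theorem map_smul_left (c : k) (f : M →ₗ[Rᵐᵒᵖ] M') (g : N →ₗ[R] N') (x : BalTensor k R M N) :
    map k (c • f) g x = c • map k f g x := by
  induction x using induction_on with
  | zero => simp
  | tmul m n => simp [smul_tmul']
  | add x y hx hy => simp only [map_add, hx, hy, smul_add]

theorem map_smul_right (c : k) (f : M →ₗ[Rᵐᵒᵖ] M') (g : N →ₗ[R] N') (x : BalTensor k R M N) :
    map k f (c • g) x = c • map k f g x := by
  induction x using induction_on with
  | zero => simp
  | tmul m n => simp [tmul_smul']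
  | add x y hx hy => simp only [map_add, hx, hy, smul_add]

theorem map_id_id (x : BalTensor k R M N) : map k LinearMap.id LinearMap.id x = x := by
  induction x using induction_on with
  | zero => simp
  | tmul m n => simp
  | add x y hx hy => simp only [map_add, hx, hy]

theorem map_map {M'' : Type*} {N'' : Type*}
    [AddCommGroup M''] [Module k M''] [Module Rᵐᵒᵖ M''] [IsScalarTower k Rᵐᵒᵖ M'']
    [AddCommGroup N''] [Module k N''] [Module R N''] [IsScalarTower k R N'']
    (f' : M' →ₗ[Rᵐᵒᵖ] M'') (g' : N' →ₗ[R] N'') (f : M →ₗ[Rᵐᵒᵖ] M') (g : N →ₗ[R] N')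
    (x : BalTensor k R M N) :
    map k f' g' (map k f g x) = map k (f' ∘ₗ f) (g' ∘ₗ g) x := by
  induction x using induction_on with
  | zero => simp
  | tmul m n => simp
  | add x y hx hy => simp only [map_add, hx, hy]

/-- `M ⊗_R N → N`, `m ⊗ n ↦ ξ(m) n`, for a right `R`-linear `ξ : M → R`. -/
noncomputable def evalL (ξ : M →ₗ[Rᵐᵒᵖ] R) : BalTensor k R M N →ₗ[k] N :=
  lift
    (LinearMap.mk₂ k (fun m n => ξ m • n)
      (fun m m' n => by rw [map_add, add_smul])
      (fun c m n => by rw [LinearMap.map_smul_of_tower, smul_assoc])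
      (fun m n n' => by rw [smul_add])
      (fun c m n => by rw [smul_algebra_smul_comm]))
    (fun m r n => by simp [mul_smul])

@[simp]
theorem evalL_tmul (ξ : M →ₗ[Rᵐᵒᵖ] R) (m : M) (n : N) :
    evalL (k := k) ξ (tmul k R m n) = ξ m • n := rfl

/-- `M ⊗_R N → M`, `m ⊗ n ↦ m χ(n)`, for a left `R`-linear `χ : N → R`. -/
noncomputable def evalR (χ : N →ₗ[R] R) : BalTensor k R M N →ₗ[k] M :=
  lift
    (LinearMap.mk₂ k (fun m n => op (χ n) • m)
      (fun m m' n => by rw [smul_add])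
      (fun c m n => by rw [smul_algebra_smul_comm])
      (fun m n n' => by rw [map_add, op_add, add_smul])
      (fun c m n => by rw [LinearMap.map_smul_of_tower, op_smul, smul_assoc]))
    (fun m r n => by simp [mul_smul])

@[simp]
theorem evalR_tmul (χ : N →ₗ[R] R) (m : M) (n : N) :
    evalR (k := k) χ (tmul k R m n) = op (χ n) • m := rfl

theorem evalL_map (ξ : M →ₗ[Rᵐᵒᵖ] R) (g : N →ₗ[R] N') (x : BalTensor k R M N) :
    evalL (k := k) ξ (map k LinearMap.id g x) = g (evalL (k := k) ξ x) := by
  induction x using induction_on with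
  | zero => simp
  | tmul m n => simp
  | add x y hx hy => simp only [map_add, hx, hy]

theorem evalR_map (f : M →ₗ[Rᵐᵒᵖ] M') (χ : N →ₗ[R] R) (x : BalTensor k R M N) :
    evalR (k := k) χ (map k f LinearMap.id x) = f (evalR (k := k) χ x) := by
  induction x using induction_on with
  | zero => simp
  | tmul m n => simp
  | add x y hx hy => simp only [map_add, hx, hy]

end Map

section Actions

variable {k : Type uk} {R : Type uR} {S : Type uS} {M : Type uM} {N : Type uN}
  [CommRing k] [Ring R] [Algebra k R] [Ring S]
  [AddCommGroup M] [Module k M] [Module Rᵐᵒᵖ M] [IsScalarTower k Rᵐᵒᵖ M]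
  [AddCommGroup N] [Module k N] [Module R N] [IsScalarTower k R N]

section Left

variable [Module S M] [SMulCommClass S Rᵐᵒᵖ M]

/-- The left action `s (m ⊗ n) = (s m) ⊗ n`. -/
noncomputable instance (priority := low) instModuleLeft : Module S (BalTensor k R M N) where
  smul s := map k (DistribSMul.toLinearMap Rᵐᵒᵖ M s) LinearMap.id
  one_smul x := by
    change map k _ _ x = x
    induction x using induction_on with
    | zero => simp
    | tmul m n => simp
    | add x y hx hy => simp only [map_add, hx, hy]
  mul_smul s t x := by
    change map k _ _ x = map k _ _ (map k _ _ x)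
    induction x using induction_on with
    | zero => simp
    | tmul m n => simp [mul_smul]
    | add x y hx hy => simp only [map_add, hx, hy]
  smul_zero s := map_zero _
  smul_add s := map_add _
  add_smul s t x := by
    change map k _ _ x = map k _ _ x + map k _ _ x
    induction x using induction_on with
    | zero => simp
    | tmul m n => simp [add_smul, add_tmul]
    | add x y hx hy => simp only [map_add, hx, hy]; abel
  zero_smul x := by
    change map k _ _ x = 0
    have h : (DistribSMul.toLinearMap Rᵐᵒᵖ M (0 : S)) = (0 : k) • LinearMap.id := by
      ext m; simp
    rw [h, map_smul_left, zero_smul]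

theorem left_smul_tmul (s : S) (m : M) (n : N) :
    s • tmul k R m n = tmul k R (s • m) n := rfl

noncomputable instance [Algebra k S] [IsScalarTower k S M] :
    IsScalarTower k S (BalTensor k R M N) where
  smul_assoc c s x := by
    induction x using induction_on with
    | zero => simp
    | tmul m n => rw [left_smul_tmul, left_smul_tmul, smul_assoc, smul_tmul']
    | add x y hx hy => simp only [smul_add, hx, hy]

end Left

section Right

variable [Module Sᵐᵒᵖ N] [SMulCommClass R Sᵐᵒᵖ N]

/-- The right action `(m ⊗ n) s = m ⊗ (n s)`. -/
noncomputable instance (priority := low) instModuleRight : Module Sᵐᵒᵖ (BalTensor k R M N) where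
  smul s := map k LinearMap.id
    { toFun := fun n => s • n
      map_add' := smul_add s
      map_smul' := fun r n => (smul_comm r s n).symm }
  one_smul x := by
    change map k _ _ x = x
    induction x using induction_on with
    | zero => simp
    | tmul m n => simp
    | add x y hx hy => simp only [map_add, hx, hy]
  mul_smul s t x := by
    change map k _ _ x = map k _ _ (map k _ _ x)
    induction x using induction_on with
    | zero => simp
    | tmul m n => simp [mul_smul]
    | add x y hx hy => simp only [map_add, hx, hy]
  smul_zero s := map_zero _
  smul_add s := map_add _
  add_smul s t x := by
    change map k _ _ x = map k _ _ x + map k _ _ x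
    induction x using induction_on with
    | zero => simp
    | tmul m n => simp [add_smul, tmul_add]
    | add x y hx hy => simp only [map_add, hx, hy]; abel
  zero_smul x := by
    change map k _ _ x = 0
    induction x using induction_on with
    | zero => simp
    | tmul m n =>
      simp
    | add x y hx hy => simp only [map_add, hx, hy, add_zero]

theorem right_smul_tmul (s : Sᵐᵒᵖ) (m : M) (n : N) :
    s • tmul k R m n = tmul k R m (s • n) := rfl

noncomputable instance [Algebra k S] [IsScalarTower k Sᵐᵒᵖ N] :
    IsScalarTower k Sᵐᵒᵖ (BalTensor k R M N) where
  smul_assoc c s x := by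
    induction x using induction_on with
    | zero => simp
    | tmul m n => rw [right_smul_tmul, right_smul_tmul, smul_assoc, tmul_smul']
    | add x y hx hy => simp only [smul_add, hx, hy]

variable {M' : Type*} [AddCommGroup M'] [Module k M'] [Module Rᵐᵒᵖ M'] [IsScalarTower k Rᵐᵒᵖ M']

variable (k N) in
/-- `f ⊗_R N` as a right linear map. -/
noncomputable def mapR (f : M →ₗ[Rᵐᵒᵖ] M') : BalTensor k R M N →ₗ[Sᵐᵒᵖ] BalTensor k R M' N where
  toFun := map k f LinearMap.id
  map_add' := map_add _
  map_smul' s x := by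
    rw [RingHom.id_apply]
    induction x using induction_on with
    | zero => simp
    | tmul m n => rfl
    | add x y hx hy => simp only [smul_add, map_add, hx, hy]

end Right

section MapL

variable [Module S M] [SMulCommClass S Rᵐᵒᵖ M]
  {N' : Type*} [AddCommGroup N'] [Module k N'] [Module R N'] [IsScalarTower k R N']

variable (k M) in
/-- `M ⊗_R g` as a left linear map. -/
noncomputable def mapL (g : N →ₗ[R] N') : BalTensor k R M N →ₗ[S] BalTensor k R M N' where
  toFun := map k LinearMap.id g
  map_add' := map_add _
  map_smul' s x := by
    rw [RingHom.id_apply]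
    induction x using induction_on with
    | zero => simp
    | tmul m n => rfl
    | add x y hx hy => simp only [smul_add, map_add, hx, hy]

end MapL

variable (k R) in
/-- The left `S`-linear map `m ↦ m ⊗ n`. -/
noncomputable def tmulR [Module S M] [SMulCommClass S Rᵐᵒᵖ M] (n : N) :
    M →ₗ[S] BalTensor k R M N where
  toFun m := tmul k R m n
  map_add' m m' := add_tmul m m' n
  map_smul' s m := (left_smul_tmul s m n).symm

variable (k R) in
/-- The right `S`-linear map `n ↦ m ⊗ n`. -/
noncomputable def tmulL [Module Sᵐᵒᵖ N] [SMulCommClass R Sᵐᵒᵖ N] (m : M) :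
    N →ₗ[Sᵐᵒᵖ] BalTensor k R M N where
  toFun n := tmul k R m n
  map_add' n n' := tmul_add m n n'
  map_smul' s n := (right_smul_tmul s m n).symm

noncomputable instance {T : Type*} [Ring T] [Module S M] [SMulCommClass S Rᵐᵒᵖ M]
    [Module Tᵐᵒᵖ N] [SMulCommClass R Tᵐᵒᵖ N] : SMulCommClass S Tᵐᵒᵖ (BalTensor k R M N) where
  smul_comm s t x := by
    induction x using induction_on with
    | zero => simp
    | tmul m n => simp only [left_smul_tmul, right_smul_tmul]
    | add x y hx hy => simp only [smul_add, hx, hy]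

end Actions

section Assoc

variable {k : Type uk} {R : Type uR} {S : Type uS} {M : Type uM} {N : Type uN} {P : Type uP}
  [CommRing k] [Ring R] [Algebra k R] [Ring S] [Algebra k S]
  [AddCommGroup M] [Module k M] [Module Rᵐᵒᵖ M] [IsScalarTower k Rᵐᵒᵖ M]
  [AddCommGroup N] [Module k N] [Module R N] [IsScalarTower k R N]
  [Module Sᵐᵒᵖ N] [IsScalarTower k Sᵐᵒᵖ N] [SMulCommClass R Sᵐᵒᵖ N]
  [AddCommGroup P] [Module k P] [Module S P] [IsScalarTower k S P]

variable (k R S M N P) in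
/-- The associativity map `(M ⊗_R N) ⊗_S P → M ⊗_R (N ⊗_S P)`, `(m ⊗ n) ⊗ p ↦ m ⊗ (n ⊗ p)`. -/
noncomputable def assoc :
    BalTensor k S (BalTensor k R M N) P →ₗ[k] BalTensor k R M (BalTensor k S N P) :=
  lift
    (LinearMap.flip
      { toFun := fun p => map k LinearMap.id (tmulR k S p)
        map_add' := fun p p' => by
          ext x
          rw [LinearMap.add_apply, ← map_add_right]
          congr 2
          ext n
          exact tmul_add n p p'
        map_smul' := fun c p => by
          ext x
          rw [LinearMap.smul_apply, RingHom.id_apply, ← map_smul_right]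
          congr 2
          ext n
          exact tmul_smul' c n p })
    (fun x s p => by
      induction x using induction_on with
      | zero => simp
      | tmul m n =>
        change tmul k R m (tmul k S (op s • n) p) = tmul k R m (tmul k S n (s • p))
        rw [op_smul_tmul]
      | add x y hx hy => simp only [smul_add, map_add, LinearMap.add_apply, hx, hy])

@[simp]
theorem assoc_tmul (m : M) (n : N) (p : P) :
    assoc k R S M N P (tmul k S (tmul k R m n) p) = tmul k R m (tmul k S n p) := rfl

theorem assoc_mapR {M' : Type*} [AddCommGroup M'] [Module k M'] [Module Rᵐᵒᵖ M']
    [IsScalarTower k Rᵐᵒᵖ M'] (f : M →ₗ[Rᵐᵒᵖ] M') (x : BalTensor k S (BalTensor k R M N) P) :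
    assoc k R S M' N P (map k (mapR k N f : _ →ₗ[Sᵐᵒᵖ] _) LinearMap.id x) =
      map k f LinearMap.id (assoc k R S M N P x) := by
  induction x using induction_on with
  | zero => simp
  | tmul y p =>
    induction y using induction_on with
    | zero => simp
    | tmul m n => rfl
    | add x y hx hy => simp only [add_tmul, map_add, hx, hy]
  | add x y hx hy => simp only [map_add, hx, hy]

theorem assoc_map {P' : Type*} [AddCommGroup P'] [Module k P'] [Module S P']
    [IsScalarTower k S P'] (g : P →ₗ[S] P') (x : BalTensor k S (BalTensor k R M N) P) :
    assoc k R S M N P' (map k LinearMap.id g x) =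
      map k LinearMap.id (mapL k N g : _ →ₗ[R] _) (assoc k R S M N P x) := by
  induction x using induction_on with
  | zero => simp
  | tmul y p =>
    induction y using induction_on with
    | zero => simp
    | tmul m n => rfl
    | add x y hx hy => simp only [add_tmul, map_add, hx, hy]
  | add x y hx hy => simp only [map_add, hx, hy]

end Assoc

end BalTensor

/-- A left `A`-module `N` is flat if `- ⊗_A N` preserves injective maps of right `A`-modules. (Right
modules in the universe of `A` suffice, since the right ideals of `A` already detect flatness.) -/
def IsFlatLeftModule (k : Type uk) (A : Type uA) (N : Type uN) [CommRing k] [Ring A] [Algebra k A]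
    [AddCommGroup N] [Module k N] [Module A N] [IsScalarTower k A N] : Prop :=
  ∀ (X Y : Type uA) [AddCommGroup X] [AddCommGroup Y] [Module k X] [Module k Y]
    [Module Aᵐᵒᵖ X] [Module Aᵐᵒᵖ Y] [IsScalarTower k Aᵐᵒᵖ X] [IsScalarTower k Aᵐᵒᵖ Y]
    (f : X →ₗ[Aᵐᵒᵖ] Y), Function.Injective f →
      Function.Injective (BalTensor.map k f (LinearMap.id : N →ₗ[A] N))

/-- An `A`-coring structure on the `A`-bimodule `C`: an `A`-bilinear coassociative coproduct
`Δ : C → C ⊗_A C` with an `A`-bilinear counit `ε : C → A`. The fields give `Δ` and `ε` as left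
`A`-linear maps that are also right `A`-linear. -/
structure Coring (k : Type uk) (A : Type uA) (C : Type uC) [CommRing k] [Ring A] [Algebra k A]
    [AddCommGroup C] [Module k C] [Module A C] [Module Aᵐᵒᵖ C] [SMulCommClass A Aᵐᵒᵖ C]
    [IsScalarTower k A C] [IsScalarTower k Aᵐᵒᵖ C] where
  /-- the coproduct -/
  comul : C →ₗ[A] BalTensor k A C C
  comul_op_smul : ∀ (a : Aᵐᵒᵖ) (c : C), comul (a • c) = a • comul c
  /-- the counit -/
  counit : C →ₗ[A] A
  counit_op_smul : ∀ (a : Aᵐᵒᵖ) (c : C), counit (a • c) = a • counit c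
  coassoc : ∀ c : C,
    BalTensor.assoc k A A C C C
      (BalTensor.map k
        ({ toFun := comul, map_add' := map_add comul, map_smul' := comul_op_smul } :
          C →ₗ[Aᵐᵒᵖ] BalTensor k A C C)
        (LinearMap.id : C →ₗ[A] C) (comul c)) =
    BalTensor.map k (LinearMap.id : C →ₗ[Aᵐᵒᵖ] C) comul (comul c)
  counit_comul : ∀ c : C,
    BalTensor.evalL (k := k)
      ({ toFun := counit, map_add' := map_add counit, map_smul' := counit_op_smul } :
        C →ₗ[Aᵐᵒᵖ] A) (comul c) = c
  comul_counit : ∀ c : C, BalTensor.evalR (k := k) counit (comul c) = c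

section Comodules

open BalTensor

variable {k : Type uk} {A : Type uA} {C : Type uC} [CommRing k] [Ring A] [Algebra k A]
  [AddCommGroup C] [Module k C] [Module A C] [Module Aᵐᵒᵖ C] [SMulCommClass A Aᵐᵒᵖ C]
  [IsScalarTower k A C] [IsScalarTower k Aᵐᵒᵖ C]

/-- The coproduct as a right `A`-linear map. -/
noncomputable def Coring.comulR (𝒞 : Coring k A C) : C →ₗ[Aᵐᵒᵖ] BalTensor k A C C where
  toFun := 𝒞.comul
  map_add' := map_add 𝒞.comul
  map_smul' := 𝒞.comul_op_smul

/-- The counit as a right `A`-linear map. -/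
def Coring.counitR (𝒞 : Coring k A C) : C →ₗ[Aᵐᵒᵖ] A where
  toFun := 𝒞.counit
  map_add' := map_add 𝒞.counit
  map_smul' := 𝒞.counit_op_smul

/-- A right `𝒞`-comodule structure on the right `A`-module `M`: a right `A`-linear coassociative
counital coaction `M → M ⊗_A C`. -/
structure RightComodule (𝒞 : Coring k A C) (M : Type uM) [AddCommGroup M] [Module k M]
    [Module Aᵐᵒᵖ M] [IsScalarTower k Aᵐᵒᵖ M] where
  /-- the coaction -/
  coact : M →ₗ[Aᵐᵒᵖ] BalTensor k A M C
  coassoc : ∀ m : M,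
    assoc k A A M C C (BalTensor.map k coact (LinearMap.id : C →ₗ[A] C) (coact m)) =
      BalTensor.map k (LinearMap.id : M →ₗ[Aᵐᵒᵖ] M) 𝒞.comul (coact m)
  coact_counit : ∀ m : M, evalR (k := k) 𝒞.counit (coact m) = m

/-- A left `𝒞`-comodule structure on the left `A`-module `N`: a left `A`-linear coassociative
counital coaction `N → C ⊗_A N`. -/
structure LeftComodule (𝒞 : Coring k A C) (N : Type uN) [AddCommGroup N] [Module k N]
    [Module A N] [IsScalarTower k A N] where
  /-- the coaction -/
  coact : N →ₗ[A] BalTensor k A C N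
  coassoc : ∀ n : N,
    assoc k A A C C N (BalTensor.map k 𝒞.comulR (LinearMap.id : N →ₗ[A] N) (coact n)) =
      BalTensor.map k (LinearMap.id : C →ₗ[Aᵐᵒᵖ] C) coact (coact n)
  counit_coact : ∀ n : N, evalL (k := k) 𝒞.counitR (coact n) = n

/-- `C` as a right `𝒞`-comodule with coaction `Δ`. -/
noncomputable def Coring.rightRegular (𝒞 : Coring k A C) : RightComodule 𝒞 C where
  coact := 𝒞.comulR
  coassoc := 𝒞.coassoc
  coact_counit := 𝒞.comul_counit

/-- `C` as a left `𝒞`-comodule with coaction `Δ`. -/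
noncomputable def Coring.leftRegular (𝒞 : Coring k A C) : LeftComodule 𝒞 C where
  coact := 𝒞.comul
  coassoc := 𝒞.coassoc
  counit_coact := 𝒞.counit_comul

variable {𝒞 : Coring k A C}

section RightHom

variable {M : Type uM} [AddCommGroup M] [Module k M] [Module Aᵐᵒᵖ M] [IsScalarTower k Aᵐᵒᵖ M]
  {N : Type uN} [AddCommGroup N] [Module k N] [Module Aᵐᵒᵖ N] [IsScalarTower k Aᵐᵒᵖ N]

/-- The `k`-module `Hom^𝒞(M, N)` of right `𝒞`-colinear maps: the right `A`-linear maps `f` with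
`ϱ^N ∘ f = (f ⊗ C) ∘ ϱ^M`. -/
def RightComodule.Hom (ρ : RightComodule 𝒞 M) (σ : RightComodule 𝒞 N) :
    Submodule k (M →ₗ[Aᵐᵒᵖ] N) where
  carrier := {f | ∀ m, σ.coact (f m) = BalTensor.map k f (LinearMap.id : C →ₗ[A] C) (ρ.coact m)}
  add_mem' {f g} hf hg m := by
    rw [LinearMap.add_apply, map_add, hf m, hg m, map_add_left]
  zero_mem' m := by
    have h : (0 : M →ₗ[Aᵐᵒᵖ] N) = (0 : k) • 0 := by simp
    rw [h, map_smul_left]; simp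
  smul_mem' c f hf m := by
    rw [LinearMap.smul_apply, LinearMap.map_smul_of_tower, hf m, map_smul_left]

/-- The endomorphism ring `End^𝒞(M)`, with composition as product. -/
def RightComodule.End (ρ : RightComodule 𝒞 M) : Subalgebra k (Module.End Aᵐᵒᵖ M) where
  carrier := {f | f ∈ RightComodule.Hom ρ ρ}
  mul_mem' {f g} hf hg m := by
    rw [Module.End.mul_apply, hf, hg, map_map]; rfl
  add_mem' hf hg := (RightComodule.Hom ρ ρ).add_mem hf hg
  algebraMap_mem' c := by
    intro m
    have h : algebraMap k (Module.End Aᵐᵒᵖ M) c = c • LinearMap.id := by ext; simp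
    rw [h, LinearMap.smul_apply, LinearMap.map_smul_of_tower, map_smul_left]
    simp [map_id_id]

noncomputable instance (ρ : RightComodule 𝒞 M) : Ring (RightComodule.End ρ) := inferInstance

noncomputable instance (ρ : RightComodule 𝒞 M) : Algebra k (RightComodule.End ρ) := inferInstance

noncomputable instance (ρ : RightComodule 𝒞 M) : Module (RightComodule.End ρ) M := inferInstance

instance (ρ : RightComodule 𝒞 M) : SMulCommClass (RightComodule.End ρ) Aᵐᵒᵖ M := inferInstance

instance (ρ : RightComodule 𝒞 M) : IsScalarTower k (RightComodule.End ρ) M := inferInstance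

noncomputable instance (ρ : RightComodule 𝒞 M) (σ : RightComodule 𝒞 N) :
    AddCommGroup (RightComodule.Hom ρ σ) := inferInstance

noncomputable instance (ρ : RightComodule 𝒞 M) (σ : RightComodule 𝒞 N) :
    Module k (RightComodule.Hom ρ σ) := inferInstance

/-- `Hom^𝒞(M, N)` is a right module over `End^𝒞(M)` with `f b = f ∘ b`. -/
instance (ρ : RightComodule 𝒞 M) (σ : RightComodule 𝒞 N) :
    Module (RightComodule.End ρ)ᵐᵒᵖ (RightComodule.Hom ρ σ) where
  smul b f := ⟨f.1 ∘ₗ (unop b).1, fun m => by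
    have hb : (unop b).1 ∈ RightComodule.Hom ρ ρ := (unop b).2
    rw [LinearMap.comp_apply, f.2, hb, map_map]; rfl⟩
  one_smul _ := rfl
  mul_smul _ _ _ := rfl
  smul_zero _ := rfl
  smul_add _ _ _ := rfl
  add_smul b b' f := by
    ext m
    exact map_add f.1 _ _
  zero_smul f := by
    ext m
    exact map_zero f.1

theorem RightComodule.op_smul_apply (ρ : RightComodule 𝒞 M) (σ : RightComodule 𝒞 N)
    (b : RightComodule.End ρ) (f : RightComodule.Hom ρ σ) (m : M) :
    (op b • f).1 m = f.1 (b • m) := rfl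

instance (ρ : RightComodule 𝒞 M) (σ : RightComodule 𝒞 N) :
    IsScalarTower k (RightComodule.End ρ)ᵐᵒᵖ (RightComodule.Hom ρ σ) where
  smul_assoc c b f := by
    ext m
    exact LinearMap.map_smul_of_tower f.1 c _

section Tensor

variable {X : Type uX} [AddCommGroup X] [Module k X] (ρ : RightComodule 𝒞 M)
  [Module (RightComodule.End ρ)ᵐᵒᵖ X] [IsScalarTower k (RightComodule.End ρ)ᵐᵒᵖ X]

variable (X) in
/-- The coaction `x ⊗ m ↦ x ⊗ m₀ ⊗ m₁` of `X ⊗_B M`, as a `k`-linear map. -/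
noncomputable def RightComodule.tensorCoact :
    BalTensor k (RightComodule.End ρ) X M →ₗ[k]
      BalTensor k A (BalTensor k (RightComodule.End ρ) X M) C :=
  BalTensor.lift
    (LinearMap.mk₂ k
      (fun x m => BalTensor.map k (tmulL k (RightComodule.End ρ) x : M →ₗ[Aᵐᵒᵖ] _)
        (LinearMap.id : C →ₗ[A] C) (ρ.coact m))
      (fun x x' m => by
        rw [← map_add_left]; congr 2; ext m; exact add_tmul x x' m)
      (fun c x m => by
        rw [← map_smul_left]; congr 2)
      (fun x m m' => by rw [map_add, map_add])
      (fun c x m => by rw [LinearMap.map_smul_of_tower, map_smul]))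
    (fun x b m => by
      have hb : b.1 ∈ RightComodule.Hom ρ ρ := b.2
      have h : ρ.coact (b • m) = _ := hb m
      simp only [LinearMap.mk₂_apply]
      rw [h, map_map]
      congr 2
      ext m
      exact op_smul_tmul x b m)

variable (X) in
/-- The coaction of `X ⊗_B M` as a right `A`-linear map. -/
noncomputable def RightComodule.tensorCoactR :
    BalTensor k (RightComodule.End ρ) X M →ₗ[Aᵐᵒᵖ]
      BalTensor k A (BalTensor k (RightComodule.End ρ) X M) C where
  toFun := RightComodule.tensorCoact X ρ
  map_add' := map_add _
  map_smul' a y := by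
    rw [RingHom.id_apply]
    induction y using induction_on with
    | zero => simp
    | tmul x m =>
      exact map_smul ((mapR k C (tmulL k (RightComodule.End ρ) x) : _ →ₗ[Aᵐᵒᵖ] _) ∘ₗ ρ.coact) a m
    | add x y hx hy => simp only [smul_add, map_add, hx, hy]

theorem RightComodule.tensorCoactR_comp (x : X) :
    RightComodule.tensorCoactR X ρ ∘ₗ tmulL k (RightComodule.End ρ) x =
      mapR k C (tmulL k (RightComodule.End ρ) x : M →ₗ[Aᵐᵒᵖ] _) ∘ₗ ρ.coact := rfl

/-- For a right `B`-module `X`, where `B = End^𝒞(M)`, the right `𝒞`-comodule `X ⊗_B M`. -/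
noncomputable def RightComodule.tensor :
    RightComodule 𝒞 (BalTensor k (RightComodule.End ρ) X M) where
  coact := RightComodule.tensorCoactR X ρ
  coassoc y := by
    induction y using induction_on with
    | zero => simp
    | tmul x m =>
      have h1 : RightComodule.tensorCoactR X ρ (tmul k (RightComodule.End ρ) x m) =
        BalTensor.map k (tmulL k (RightComodule.End ρ) x : M →ₗ[Aᵐᵒᵖ] _)
          (LinearMap.id : C →ₗ[A] C) (ρ.coact m) := rfl
      rw [h1, map_map, map_map, RightComodule.tensorCoactR_comp]
      have h2 := map_map (k := k) (mapR k C (tmulL k (RightComodule.End ρ) x : M →ₗ[Aᵐᵒᵖ] _))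
        (LinearMap.id : C →ₗ[A] C) ρ.coact (LinearMap.id : C →ₗ[A] C) (ρ.coact m)
      rw [← h2, assoc_mapR, ρ.coassoc, map_map]
      rfl
    | add x y hx hy => simp only [map_add, hx, hy]
  coact_counit y := by
    induction y using induction_on with
    | zero => simp
    | tmul x m =>
      have h1 : RightComodule.tensorCoactR X ρ (tmul k (RightComodule.End ρ) x m) =
        BalTensor.map k (tmulL k (RightComodule.End ρ) x : M →ₗ[Aᵐᵒᵖ] _)
          (LinearMap.id : C →ₗ[A] C) (ρ.coact m) := rfl
      rw [h1, evalR_map, ρ.coact_counit]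
      rfl
    | add x y hx hy => simp only [map_add, hx, hy]

end Tensor

/-- The map `Hom^𝒞(M, N) ⊗_B M → N`, `f ⊗ m ↦ f(m)`. -/
noncomputable def RightComodule.evaluationMap (ρ : RightComodule 𝒞 M) (σ : RightComodule 𝒞 N) :
    BalTensor k (RightComodule.End ρ) (RightComodule.Hom ρ σ) M →ₗ[Aᵐᵒᵖ] N :=
  let e : BalTensor k (RightComodule.End ρ) (RightComodule.Hom ρ σ) M →ₗ[k] N :=
    BalTensor.lift
      (LinearMap.mk₂ k (fun (f : RightComodule.Hom ρ σ) (m : M) => f.1 m)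
        (fun _ _ _ => rfl) (fun _ _ _ => rfl) (fun f => map_add f.1)
        (fun c f m => LinearMap.map_smul_of_tower f.1 c m))
      (fun _ _ _ => rfl)
  { toFun := e
    map_add' := map_add e
    map_smul' := fun a y => by
      rw [RingHom.id_apply]
      induction y using induction_on with
      | zero => simp
      | tmul f m => exact map_smul f.1 a m
      | add x y hx hy => rw [smul_add, map_add, map_add, smul_add, hx, hy] }

theorem RightComodule.evaluationMap_mem (ρ : RightComodule 𝒞 M) (σ : RightComodule 𝒞 N) :
    RightComodule.evaluationMap ρ σ ∈
      RightComodule.Hom (RightComodule.tensor (X := RightComodule.Hom ρ σ) ρ) σ := by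
  intro y
  induction y using induction_on with
  | zero => rw [map_zero, map_zero, map_zero, map_zero]
  | tmul f m =>
    have h1 : (RightComodule.tensor ρ).coact (tmul k (RightComodule.End ρ) f m) =
      BalTensor.map k (tmulL k (RightComodule.End ρ) f : M →ₗ[Aᵐᵒᵖ] _)
        (LinearMap.id : C →ₗ[A] C) (ρ.coact m) := rfl
    rw [h1, map_map]
    exact f.2 m
  | add x y hx hy => rw [map_add, map_add, map_add, map_add, hx, hy]

/-- The evaluation map `φ_N : Hom^𝒞(M, N) ⊗_B M → N`, `f ⊗ m ↦ f(m)`, as a morphism of right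
`𝒞`-comodules. -/
noncomputable def RightComodule.evaluation (ρ : RightComodule 𝒞 M) (σ : RightComodule 𝒞 N) :
    RightComodule.Hom (RightComodule.tensor (X := RightComodule.Hom ρ σ) ρ) σ :=
  ⟨RightComodule.evaluationMap ρ σ, RightComodule.evaluationMap_mem ρ σ⟩

theorem RightComodule.evaluation_tmul (ρ : RightComodule 𝒞 M) (σ : RightComodule 𝒞 N)
    (f : RightComodule.Hom ρ σ) (m : M) :
    (RightComodule.evaluation ρ σ).1 (tmul k (RightComodule.End ρ) f m) = f.1 m := rfl

/-- A morphism of right `𝒞`-comodules is an isomorphism if it has an inverse morphism. -/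
def RightComodule.IsIso (ρ : RightComodule 𝒞 M) (σ : RightComodule 𝒞 N)
    (f : RightComodule.Hom ρ σ) : Prop :=
  ∃ g : RightComodule.Hom σ ρ, g.1 ∘ₗ f.1 = LinearMap.id ∧ f.1 ∘ₗ g.1 = LinearMap.id

/-- A Galois comodule: `M` is a finitely generated projective right `A`-module and the evaluation
map `φ_C : Hom^𝒞(M, C) ⊗_B M → C` is an isomorphism of right `𝒞`-comodules. -/
def RightComodule.IsGalois (ρ : RightComodule 𝒞 M) : Prop :=
  Module.Finite Aᵐᵒᵖ M ∧ Module.Projective Aᵐᵒᵖ M ∧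
    RightComodule.IsIso _ _ (RightComodule.evaluation ρ 𝒞.rightRegular)

/-- A principal comodule: a Galois comodule that is projective as a left module over its
endomorphism ring `B = End^𝒞(M)`. -/
def RightComodule.IsPrincipal (ρ : RightComodule 𝒞 M) : Prop :=
  RightComodule.IsGalois ρ ∧ Module.Projective (RightComodule.End ρ) M

end RightHom

section LeftHom

variable {N : Type uN} [AddCommGroup N] [Module k N] [Module A N] [IsScalarTower k A N]
  {P : Type uP} [AddCommGroup P] [Module k P] [Module A P] [IsScalarTower k A P]

/-- The `k`-module of left `𝒞`-colinear maps: the left `A`-linear maps `f` with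
`ϱ^P ∘ f = (C ⊗ f) ∘ ϱ^N`. -/
def LeftComodule.Hom (lam : LeftComodule 𝒞 N) (mu : LeftComodule 𝒞 P) :
    Submodule k (N →ₗ[A] P) where
  carrier := {f | ∀ n, mu.coact (f n) = BalTensor.map k (LinearMap.id : C →ₗ[Aᵐᵒᵖ] C) f (lam.coact n)}
  add_mem' {f g} hf hg m := by
    rw [LinearMap.add_apply, map_add, hf m, hg m, map_add_right]
  zero_mem' m := by
    have h : (0 : N →ₗ[A] P) = (0 : k) • 0 := by simp
    rw [h, map_smul_right]; simp
  smul_mem' c f hf m := by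
    rw [LinearMap.smul_apply, LinearMap.map_smul_of_tower, hf m, map_smul_right]

/-- A morphism of left `𝒞`-comodules is a split epimorphism if it has a right inverse that is a
morphism of left `𝒞`-comodules. -/
def LeftComodule.IsSplitEpi (lam : LeftComodule 𝒞 N) (mu : LeftComodule 𝒞 P)
    (f : LeftComodule.Hom lam mu) : Prop :=
  ∃ s : LeftComodule.Hom mu lam, f.1 ∘ₗ s.1 = LinearMap.id

variable (V : Type uX) [AddCommGroup V] [Module k V]

/-- The left `A`-linear map `n ⊗ v ↦ n₋₁ ⊗ n₀ ⊗ v`. -/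
noncomputable def LeftComodule.tensorCoact (lam : LeftComodule 𝒞 N) :
    N ⊗[k] V →ₗ[A] BalTensor k A C (N ⊗[k] V) :=
  TensorProduct.AlgebraTensorModule.lift
    { toFun := fun n =>
        { toFun := fun v => BalTensor.map k (LinearMap.id : C →ₗ[Aᵐᵒᵖ] C)
            ((TensorProduct.AlgebraTensorModule.mk k A N V).flip v) (lam.coact n)
          map_add' := fun v w => by
            rw [← map_add_right, map_add]
          map_smul' := fun c v => by
            rw [RingHom.id_apply, ← map_smul_right, map_smul] }
      map_add' := fun n n' => by
        ext v; simp
      map_smul' := fun a n => by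
        ext v
        simp only [map_smul, LinearMap.coe_mk, AddHom.coe_mk, RingHom.id_apply,
          LinearMap.smul_apply]
        induction lam.coact n using induction_on with
        | zero => simp
        | tmul c n => rfl
        | add x y hx hy => simp only [smul_add, map_add, hx, hy] }

theorem LeftComodule.tensorCoact_tmul (lam : LeftComodule 𝒞 N) (n : N) (v : V) :
    lam.tensorCoact V (n ⊗ₜ[k] v) = BalTensor.map k (LinearMap.id : C →ₗ[Aᵐᵒᵖ] C)
      ((TensorProduct.AlgebraTensorModule.mk k A N V).flip v) (lam.coact n) := rfl

/-- For a left `𝒞`-comodule `N` and a `k`-module `V`, the left `𝒞`-comodule `N ⊗_k V` with coaction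
`n ⊗ v ↦ n₋₁ ⊗ n₀ ⊗ v`. -/
noncomputable def LeftComodule.tensor (lam : LeftComodule 𝒞 N) : LeftComodule 𝒞 (N ⊗[k] V) where
  coact := lam.tensorCoact V
  coassoc y := by
    induction y using TensorProduct.induction_on with
    | zero => simp
    | tmul n v =>
      rw [LeftComodule.tensorCoact_tmul, map_map]
      have h1 := map_map (k := k) (LinearMap.id : BalTensor k A C C →ₗ[Aᵐᵒᵖ] _)
        ((TensorProduct.AlgebraTensorModule.mk k A N V).flip v) 𝒞.comulR
        (LinearMap.id : N →ₗ[A] N) (lam.coact n)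
      have h2 := map_map (k := k) (LinearMap.id : C →ₗ[Aᵐᵒᵖ] C)
        (mapL k C ((TensorProduct.AlgebraTensorModule.mk k A N V).flip v) : _ →ₗ[A] _)
        (LinearMap.id : C →ₗ[Aᵐᵒᵖ] C) lam.coact (lam.coact n)
      rw [LinearMap.comp_id, LinearMap.id_comp, ← LinearMap.id_comp 𝒞.comulR,
        ← LinearMap.comp_id ((TensorProduct.AlgebraTensorModule.mk k A N V).flip v), ← h1,
        assoc_map, lam.coassoc, h2, map_map]
      rfl
    | add x y hx hy => simp only [map_add, hx, hy]
  counit_coact y := by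
    induction y using TensorProduct.induction_on with
    | zero => simp
    | tmul n v =>
      rw [LeftComodule.tensorCoact_tmul, evalL_map, lam.counit_coact]
      rfl
    | add x y hx hy => simp only [map_add, hx, hy]

end LeftHom

section Dual

variable {M : Type uM} [AddCommGroup M] [Module k M] [Module Aᵐᵒᵖ M] [IsScalarTower k Aᵐᵒᵖ M]

/-- A finite dual basis of the right `A`-module `M`: `e i ∈ M` and `ξ i ∈ M* = Hom_A(M, A)` with
`m = ∑ i, e i ξ i(m)`. -/
structure DualBasis (A : Type uA) [Ring A] (M : Type uM) [AddCommGroup M] [Module Aᵐᵒᵖ M] where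
  n : ℕ
  e : Fin n → M
  ξ : Fin n → M →ₗ[Aᵐᵒᵖ] A
  sum_eq : ∀ m : M, ∑ i, op (ξ i m) • e i = m

theorem DualBasis.nonempty (A : Type uA) [Ring A] (M : Type uM) [AddCommGroup M] [Module Aᵐᵒᵖ M]
    [Module.Finite Aᵐᵒᵖ M] [Module.Projective Aᵐᵒᵖ M] : Nonempty (DualBasis A M) := by
  obtain ⟨n, f, g, -, -, hfg⟩ := Module.Finite.exists_comp_eq_id_of_projective Aᵐᵒᵖ M
  refine ⟨⟨n, fun i => f (Pi.single i 1), fun i =>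
    { toFun := fun m => unop (g m i)
      map_add' := fun m m' => by simp
      map_smul' := fun a m => by simp }, fun m => ?_⟩⟩
  have h : f (g m) = m := LinearMap.congr_fun hfg m
  conv_rhs => rw [← h, LinearMap.pi_apply_eq_sum_univ f (g m)]
  refine Finset.sum_congr rfl fun i _ => ?_
  change g m i • f (Pi.single i 1) = _
  congr 2
  ext j
  simp [Pi.single_apply, eq_comm]

/-- A finite dual basis of a finitely generated projective right module. -/
noncomputable def DualBasis.choose (A : Type uA) [Ring A] (M : Type uM) [AddCommGroup M]
    [Module Aᵐᵒᵖ M] [Module.Finite Aᵐᵒᵖ M] [Module.Projective Aᵐᵒᵖ M] : DualBasis A M :=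
  (DualBasis.nonempty A M).some

theorem DualBasis.sum_tmul_evalL (d : DualBasis A M) {P : Type uP} [AddCommGroup P] [Module k P]
    [Module Aᵐᵒᵖ P] [IsScalarTower k Aᵐᵒᵖ P] {N : Type uN} [AddCommGroup N] [Module k N]
    [Module A N] [IsScalarTower k A N] (f : M →ₗ[Aᵐᵒᵖ] P) (x : BalTensor k A M N) :
    ∑ i, tmul k A (f (d.e i)) (evalL (k := k) (d.ξ i) x) = BalTensor.map k f LinearMap.id x := by
  induction x using induction_on with
  | zero => simp
  | tmul m n =>
    have h (p : Fin d.n → P) : ∑ i, tmul k A (p i) n = tmul k A (∑ i, p i) n :=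
      (map_sum (AddMonoidHom.mk' (fun q : P => tmul k A q n) fun q q' => add_tmul q q' n) p _).symm
    simp only [evalL_tmul, ← op_smul_tmul, map_tmul, ← map_smul]
    rw [h, ← map_sum, d.sum_eq]
    rfl
  | add x y hx hy => simp only [map_add, tmul_add, Finset.sum_add_distrib, hx, hy]

/-- The right `A`-linear map `M → C`, `m ↦ ξ(m₀) m₁`, for `ξ ∈ M*`. -/
noncomputable def RightComodule.slice (ρ : RightComodule 𝒞 M) (ξ : M →ₗ[Aᵐᵒᵖ] A) :
    M →ₗ[Aᵐᵒᵖ] C where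
  toFun m := evalL (k := k) ξ (ρ.coact m)
  map_add' m m' := by rw [map_add, map_add]
  map_smul' a m := by
    rw [map_smul, RingHom.id_apply]
    induction ρ.coact m using induction_on with
    | zero => simp
    | tmul m c => exact smul_comm (ξ m) a c
    | add x y hx hy => simp only [smul_add, map_add, hx, hy]

theorem RightComodule.slice_add (ρ : RightComodule 𝒞 M) (ξ ξ' : M →ₗ[Aᵐᵒᵖ] A) :
    ρ.slice (ξ + ξ') = ρ.slice ξ + ρ.slice ξ' := by
  ext m
  change evalL (k := k) (ξ + ξ') (ρ.coact m) =
    evalL (k := k) ξ (ρ.coact m) + evalL (k := k) ξ' (ρ.coact m)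
  induction ρ.coact m using induction_on with
  | zero => simp
  | tmul m c => simp [add_smul]
  | add x y hx hy => simp only [map_add, hx, hy]; abel

theorem RightComodule.slice_smul (ρ : RightComodule 𝒞 M) (a : A) (ξ : M →ₗ[Aᵐᵒᵖ] A) (m : M) :
    ρ.slice (a • ξ) m = a • ρ.slice ξ m := by
  change evalL (k := k) (a • ξ) (ρ.coact m) = a • evalL (k := k) ξ (ρ.coact m)
  induction ρ.coact m using induction_on with
  | zero => simp
  | tmul m c => simp [mul_smul]
  | add x y hx hy => simp only [map_add, smul_add, hx, hy]

theorem RightComodule.comul_slice (ρ : RightComodule 𝒞 M) (ξ : M →ₗ[Aᵐᵒᵖ] A) (m : M) :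
    𝒞.comul (ρ.slice ξ m) = BalTensor.map k (ρ.slice ξ) LinearMap.id (ρ.coact m) := by
  change 𝒞.comul (evalL (k := k) ξ (ρ.coact m)) = _
  rw [← evalL_map, ← ρ.coassoc]
  induction ρ.coact m using induction_on with
  | zero => simp
  | tmul m c =>
    change evalL (k := k) ξ (BalTensor.assoc k A A M C C (tmul k A (ρ.coact m) c)) =
      tmul k A (evalL (k := k) ξ (ρ.coact m)) c
    induction ρ.coact m using induction_on with
    | zero => simp
    | tmul m c => rfl
    | add x y hx hy => simp only [add_tmul, map_add, hx, hy]
  | add x y hx hy => simp only [map_add, hx, hy]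

theorem RightComodule.counit_slice (ρ : RightComodule 𝒞 M) (ξ : M →ₗ[Aᵐᵒᵖ] A) (m : M) :
    𝒞.counit (ρ.slice ξ m) = ξ m := by
  conv_rhs => rw [← ρ.coact_counit m]
  change 𝒞.counit (evalL (k := k) ξ (ρ.coact m)) = _
  induction ρ.coact m using induction_on with
  | zero => simp
  | tmul m c => simp
  | add x y hx hy => simp only [map_add, hx, hy]

/-- The left `𝒞`-comodule `M*` with coaction `ξ ↦ ∑ i, ξ(e i₀) e i₁ ⊗ ξ i`, for a finite dual basis
`(e, ξ)` of `M`. -/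
noncomputable def RightComodule.dualOf (ρ : RightComodule 𝒞 M) (d : DualBasis A M) :
    LeftComodule 𝒞 (M →ₗ[Aᵐᵒᵖ] A) where
  coact :=
    { toFun := fun ξ => ∑ i, tmul k A (ρ.slice ξ (d.e i)) (d.ξ i)
      map_add' := fun ξ ξ' => by
        simp [RightComodule.slice_add, add_tmul, Finset.sum_add_distrib]
      map_smul' := fun a ξ => by
        simp [RightComodule.slice_smul, Finset.smul_sum, left_smul_tmul] }
  coassoc ξ := by
    have h (i : Fin d.n) : 𝒞.comul (ρ.slice ξ (d.e i)) =
        ∑ j, tmul k A (ρ.slice ξ (d.e j)) (ρ.slice (d.ξ j) (d.e i)) := by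
      rw [ρ.comul_slice, ← d.sum_tmul_evalL]; rfl
    have h' (x : Fin d.n → BalTensor k A C C) (η : M →ₗ[Aᵐᵒᵖ] A) :
        tmul k A (∑ i, x i) η = ∑ i, tmul k A (x i) η :=
      map_sum (AddMonoidHom.mk' (fun q => tmul k A q η) fun q q' => add_tmul q q' η) x _
    have h'' (c : C) (y : Fin d.n → BalTensor k A C (M →ₗ[Aᵐᵒᵖ] A)) :
        tmul k A c (∑ i, y i) = ∑ i, tmul k A c (y i) :=
      map_sum (AddMonoidHom.mk' (fun q => tmul k A c q) fun q q' => tmul_add c q q') y _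
    have hc (c : C) : 𝒞.comulR c = 𝒞.comul c := rfl
    simp only [LinearMap.coe_mk, AddHom.coe_mk, map_sum, map_tmul, LinearMap.id_apply, hc, h, h',
      h'', assoc_tmul]
    exact Finset.sum_comm
  counit_coact ξ := by
    ext m
    have hc (c : C) : 𝒞.counitR c = 𝒞.counit c := rfl
    simp only [LinearMap.coe_mk, AddHom.coe_mk, map_sum, evalL_tmul, hc, ρ.counit_slice,
      LinearMap.sum_apply, LinearMap.smul_apply]
    conv_rhs => rw [← d.sum_eq m, map_sum]
    simp

/-- The coaction of `M*` does not depend on the dual basis. -/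
theorem RightComodule.dualOf_eq (ρ : RightComodule 𝒞 M) (d d' : DualBasis A M) :
    ρ.dualOf d = ρ.dualOf d' := by
  have h : (ρ.dualOf d).coact = (ρ.dualOf d').coact := by
    ext ξ
    change ∑ i, tmul k A (ρ.slice ξ (d.e i)) (d.ξ i) =
      ∑ j, tmul k A (ρ.slice ξ (d'.e j)) (d'.ξ j)
    have h1 (j : Fin d'.n) : d'.ξ j = ∑ i, d'.ξ j (d.e i) • d.ξ i := by
      ext m
      conv_lhs => rw [← d.sum_eq m, map_sum]
      simp
    have h2 (i : Fin d.n) : ρ.slice ξ (d.e i) =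
        ∑ j, op (d'.ξ j (d.e i)) • ρ.slice ξ (d'.e j) := by
      conv_lhs => rw [← d'.sum_eq (d.e i), map_sum]
      simp
    have h3 (x : Fin d'.n → C) (η : M →ₗ[Aᵐᵒᵖ] A) :
        tmul k A (∑ i, x i) η = ∑ i, tmul k A (x i) η :=
      map_sum (AddMonoidHom.mk' (fun q => tmul k A q η) fun q q' => add_tmul q q' η) x _
    have h4 (c : C) (y : Fin d.n → M →ₗ[Aᵐᵒᵖ] A) :
        tmul k A c (∑ i, y i) = ∑ i, tmul k A c (y i) :=
      map_sum (AddMonoidHom.mk' (fun q => tmul k A c q) fun q q' => tmul_add c q q') y _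
    calc _ = ∑ i, ∑ j, tmul k A (ρ.slice ξ (d'.e j)) (d'.ξ j (d.e i) • d.ξ i) := by
          refine Finset.sum_congr rfl fun i _ => ?_
          rw [h2, h3]
          exact Finset.sum_congr rfl fun j _ => op_smul_tmul _ _ _
      _ = ∑ j, ∑ i, tmul k A (ρ.slice ξ (d'.e j)) (d'.ξ j (d.e i) • d.ξ i) := Finset.sum_comm
      _ = _ := by
          refine Finset.sum_congr rfl fun j _ => ?_
          rw [← h4, ← h1]
  cases hd : ρ.dualOf d
  cases hd' : ρ.dualOf d'
  rw [hd, hd'] at h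
  cases h
  rfl

/-- The left `𝒞`-comodule `M*` of a right `𝒞`-comodule `M` that is finitely generated and projective
as a right `A`-module. -/
noncomputable def RightComodule.dual (ρ : RightComodule 𝒞 M) [Module.Finite Aᵐᵒᵖ M]
    [Module.Projective Aᵐᵒᵖ M] : LeftComodule 𝒞 (M →ₗ[Aᵐᵒᵖ] A) :=
  ρ.dualOf (DualBasis.choose A M)

/-- The left `A`-linear map `M* ⊗_k M → C`, `ξ ⊗ m ↦ ξ(m₀) m₁`. -/
noncomputable def RightComodule.canMap (ρ : RightComodule 𝒞 M) :
    (M →ₗ[Aᵐᵒᵖ] A) ⊗[k] M →ₗ[A] C :=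
  TensorProduct.AlgebraTensorModule.lift
    { toFun := fun ξ => (ρ.slice ξ).restrictScalars k
      map_add' := fun ξ ξ' => by rw [ρ.slice_add]; rfl
      map_smul' := fun a ξ => by ext m; exact ρ.slice_smul a ξ m }

theorem RightComodule.canMap_tmul (ρ : RightComodule 𝒞 M) (ξ : M →ₗ[Aᵐᵒᵖ] A) (m : M) :
    ρ.canMap (ξ ⊗ₜ[k] m) = evalL (k := k) ξ (ρ.coact m) := rfl

/-- The canonical map `M* ⊗_k M → C`, `ξ ⊗ m ↦ ξ(m₀) m₁`, as a morphism of left `𝒞`-comodules. -/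
noncomputable def RightComodule.can (ρ : RightComodule 𝒞 M) [Module.Finite Aᵐᵒᵖ M]
    [Module.Projective Aᵐᵒᵖ M] : LeftComodule.Hom (ρ.dual.tensor M) 𝒞.leftRegular :=
  ⟨ρ.canMap, fun y => by
    induction y using TensorProduct.induction_on with
    | zero => rw [map_zero, map_zero, map_zero, map_zero]
    | tmul ξ m =>
      have h1 : (ρ.dual.tensor M).coact (ξ ⊗ₜ[k] m) =
        BalTensor.map k (LinearMap.id : C →ₗ[Aᵐᵒᵖ] C)
          ((TensorProduct.AlgebraTensorModule.mk k A (M →ₗ[Aᵐᵒᵖ] A) M).flip m)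
          (∑ i, tmul k A (ρ.slice ξ ((DualBasis.choose A M).e i)) ((DualBasis.choose A M).ξ i)) := rfl
      rw [h1, map_map, map_sum]
      exact (ρ.comul_slice ξ m).trans
        ((DualBasis.choose A M).sum_tmul_evalL (ρ.slice ξ) (ρ.coact m)).symm
    | add x y hx hy => rw [map_add, map_add, map_add, map_add, hx, hy]⟩

end Dual

end Comodules

/-!
Let `s : C → M* ⊗ M` be a left colinear section of the canonical map. As `M` is projective over `k`,
it has `k`-linear coordinates `m = ∑ i, f_i(m) v_i`, so that `s(c) = ∑ i, h_i(c) ⊗ v_i` with left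
colinear maps `h_i = (M* ⊗ f_i) ∘ s : C → M*`. For `m ∈ M` put `b_i(m) = m₀ h_i(m₁)(-)`, an `A`-linear
endomorphism of `M`. Everything rests on three facts:

* `b_i(m)` is right colinear, i.e. lies in `B` (`RightComodule.contract_coact_mem`), because `h_i` is
  left colinear: evaluated at `n`, this says `c₁ h_i(c₂)(n) = h_i(c)(n₀) n₁`;
* `b_i` is left `B`-linear in `m`, because elements of `B` commute with the coaction;
* `∑ i, b_i(m)(v_i) = m` (`contract_sum`), because `∑ i, h_i(c)(v_i) = ε(can(s(c))) = ε(c)`.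

Hence `m ↦ (b_i(m))_i` splits the `B`-linear map `B^(ι) → M` given by the `v_i`, and `M` is projective
over `B` (`RightComodule.projective_of_splitting`).

For the evaluation map, `ξ ↦ (m ↦ ξ(m₀) m₁)` identifies `M*` with `Hom^𝒞(M, C)`, with inverse
`f ↦ ε ∘ f`, and turns the evaluation map into the map `M* ⊗_B M → C` induced by the canonical map.
Its inverse sends `c` to the class of `s(c)`: one composite is the identity as `can ∘ s = id`, the
other because `s(ξ(m₀) m₁) = ∑ i, (ξ ∘ b_i(m)) ⊗ v_i`, where `b_i(m) ∈ B` may be moved across `⊗_B`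
(`RightComodule.dualTensorToHomTensor_slice`).
-/

/-! ### Contracting tensors with the dual module -/

section Pairing

open BalTensor

variable {k : Type uk} {A : Type uA} {M : Type uM} [CommRing k] [Ring A] [Algebra k A]
  [AddCommGroup M] [Module Aᵐᵒᵖ M]
  {P : Type*} [AddCommGroup P] [Module k P] [Module Aᵐᵒᵖ P] [IsScalarTower k Aᵐᵒᵖ P]
  {N : Type*} [AddCommGroup N] [Module k N] [Module A N] [IsScalarTower k A N]

theorem BalTensor.evalL_comp [Module k M] [IsScalarTower k Aᵐᵒᵖ M] (ξ : P →ₗ[Aᵐᵒᵖ] A)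
    (f : M →ₗ[Aᵐᵒᵖ] P) (x : BalTensor k A M N) :
    evalL (k := k) (ξ ∘ₗ f) x = evalL (k := k) ξ (BalTensor.map k f LinearMap.id x) := by
  induction x using induction_on with
  | zero => simp
  | tmul m n => rfl
  | add x y hx hy => simp only [map_add, hx, hy]

/-- The right `A`-linear map `M → P` of rank one, `n ↦ p ξ(n)`, for `p ∈ P` and `ξ ∈ M*`. -/
def rankOne (p : P) (ξ : M →ₗ[Aᵐᵒᵖ] A) : M →ₗ[Aᵐᵒᵖ] P where
  toFun n := op (ξ n) • p
  map_add' n n' := by rw [map_add, op_add, add_smul]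
  map_smul' a n := by
    rw [map_smul, RingHom.id_apply, ← mul_smul]
    rfl

theorem rankOne_apply (p : P) (ξ : M →ₗ[Aᵐᵒᵖ] A) (n : M) : rankOne p ξ n = op (ξ n) • p := rfl

variable (k) in
/-- The `k`-linear map `M* → Hom_A(M, P)`, `ξ ↦ p ξ(-)`, for a fixed `p ∈ P`. -/
def rankOneL (p : P) : (M →ₗ[Aᵐᵒᵖ] A) →ₗ[k] (M →ₗ[Aᵐᵒᵖ] P) where
  toFun := rankOne p
  map_add' ξ ξ' := by ext n; simp [rankOne_apply, add_smul]
  map_smul' c ξ := by ext n; simp [rankOne_apply]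

theorem tmul_evalL [Module k M] [IsScalarTower k Aᵐᵒᵖ M] (p : P) (ξ : M →ₗ[Aᵐᵒᵖ] A)
    (y : BalTensor k A M N) :
    tmul k A p (evalL (k := k) ξ y) = BalTensor.map k (rankOne p ξ) LinearMap.id y := by
  induction y using induction_on with
  | zero => simp
  | tmul m n => exact (op_smul_tmul _ _ _).symm
  | add x y hx hy => simp only [map_add, tmul_add, hx, hy]

/-- For `h : N → M*^(ι)`, the map `P ⊗_A N → Hom_A(M, P)^(ι)`, `p ⊗ n ↦ (p h_i(n)(-))_i`. -/
noncomputable def contract {ι : Type*} (h : N →ₗ[A] ι →₀ (M →ₗ[Aᵐᵒᵖ] A)) :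
    BalTensor k A P N →ₗ[k] ι →₀ (M →ₗ[Aᵐᵒᵖ] P) :=
  lift
    { toFun := fun p => Finsupp.mapRange.linearMap (rankOneL k p) ∘ₗ h.restrictScalars k
      map_add' := fun p p' => by
        ext n i x
        simp [rankOneL, rankOne_apply]
      map_smul' := fun c p => by
        ext n i x
        simp [rankOneL, rankOne_apply, smul_algebra_smul_comm] }
    (fun p a n => by
      ext i x
      simp [rankOneL, rankOne_apply, mul_smul])

theorem contract_tmul {ι : Type*} (h : N →ₗ[A] ι →₀ (M →ₗ[Aᵐᵒᵖ] A)) (p : P) (n : N) (i : ι) :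
    contract h (tmul k A p n) i = rankOne p (h n i) := by
  change Finsupp.mapRange.linearMap (rankOneL k p) (h n) i = _
  simp [rankOneL]

theorem contract_map {ι : Type*} (h : N →ₗ[A] ι →₀ (M →ₗ[Aᵐᵒᵖ] A))
    {Q : Type*} [AddCommGroup Q] [Module k Q] [Module Aᵐᵒᵖ Q] [IsScalarTower k Aᵐᵒᵖ Q]
    (f : P →ₗ[Aᵐᵒᵖ] Q) (x : BalTensor k A P N) (i : ι) :
    contract h (BalTensor.map k f LinearMap.id x) i = f ∘ₗ contract h x i := by
  induction x using induction_on with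
  | zero => simp
  | tmul p n =>
    ext m
    simp [contract_tmul, rankOne_apply]
  | add x y hx hy => simp only [map_add, Finsupp.add_apply, LinearMap.comp_add, hx, hy]

variable (k) in
/-- `P ⊗_A N → P`, `p ⊗ n ↦ p χ(n)`, as a left linear map for a bimodule `P`. -/
noncomputable def evalRLeft {S : Type*} [Ring S] [Module S P] [SMulCommClass S Aᵐᵒᵖ P]
    (χ : N →ₗ[A] A) : BalTensor k A P N →ₗ[S] P where
  toFun := evalR (k := k) χ
  map_add' := map_add _
  map_smul' s x := by
    rw [RingHom.id_apply]
    induction x using induction_on with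
    | zero => simp
    | tmul p n => exact (smul_comm s (op (χ n)) p).symm
    | add x y hx hy => simp only [smul_add, map_add, hx, hy]

/-- `n ↦ h_i(n)(m)` for `h : N → M*^(ι)`. -/
noncomputable def applyCoord {ι : Type*} (h : N →ₗ[A] ι →₀ (M →ₗ[Aᵐᵒᵖ] A)) (i : ι) (m : M) :
    N →ₗ[A] A :=
  LinearMap.applyₗ' A m ∘ₗ Finsupp.lapply i ∘ₗ h

theorem contract_apply {ι : Type*} (h : N →ₗ[A] ι →₀ (M →ₗ[Aᵐᵒᵖ] A)) (x : BalTensor k A P N)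
    (i : ι) (m : M) : contract h x i m = evalR (k := k) (applyCoord h i m) x := by
  induction x using induction_on with
  | zero => simp
  | tmul p n => rw [contract_tmul]; rfl
  | add x y hx hy => simp only [map_add, Finsupp.add_apply, LinearMap.add_apply, hx, hy]

/-- If `∑ i, h_i(n)(v_i) = χ(n)`, then summing the values at `v_i` of the contraction of `p ⊗ n`
gives `p χ(n)`. -/
theorem contract_sum {ι : Type*} (h : N →ₗ[A] ι →₀ (M →ₗ[Aᵐᵒᵖ] A)) (v : ι → M) (χ : N →ₗ[A] A)
    (hχ : ∀ n, (h n).sum (fun i ξ => ξ (v i)) = χ n) (x : BalTensor k A P N) :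
    (contract h x).sum (fun i b => b (v i)) = evalR (k := k) χ x := by
  induction x using induction_on with
  | zero => simp
  | tmul p n =>
    have hs : (contract h (tmul k A p n)).support ⊆ (h n).support := fun i hi => by
      contrapose! hi
      have h0 : h n i = 0 := by simpa using hi
      rw [Finsupp.notMem_support_iff, contract_tmul, h0]
      ext m
      simp [rankOne_apply]
    rw [Finsupp.sum_of_support_subset _ hs _ (by simp), evalR_tmul, ← hχ, Finsupp.sum, Finset.op_sum,
      Finset.sum_smul]
    exact Finset.sum_congr rfl fun i _ => by rw [contract_tmul, rankOne_apply]
  | add x y hx hy =>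
    rw [map_add, Finsupp.sum_add_index' (by simp) (by simp), hx, hy, map_add]

end Pairing

/-! ### Coordinates on tensor products over the base ring -/

section Coordinates

variable {k : Type uk} {A : Type uA} {M : Type uM} [CommRing k] [Ring A] [Algebra k A]
  [AddCommGroup M] [Module k M]
  {N : Type*} [AddCommGroup N] [Module k N] [Module A N] [IsScalarTower k A N]

variable (A N) in
/-- The map `N ⊗_k M → N`, `n ⊗ m ↦ f(m) n`, for a `k`-linear functional `f` on `M`. -/
noncomputable def tensorFunctional (f : M →ₗ[k] k) : N ⊗[k] M →ₗ[A] N :=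
  (TensorProduct.AlgebraTensorModule.rid k A N).toLinearMap ∘ₗ
    TensorProduct.AlgebraTensorModule.map LinearMap.id f

theorem tensorFunctional_tmul (f : M →ₗ[k] k) (n : N) (m : M) :
    tensorFunctional A N f (n ⊗ₜ[k] m) = f m • n := by
  simp [tensorFunctional]

variable (A N) in
/-- The coordinates `N ⊗_k M → N^(ι)` with respect to `k`-linear coordinates `M → k^(ι)`. -/
noncomputable def tensorCoord {ι : Type*} [DecidableEq ι] (f : M →ₗ[k] ι →₀ k) :
    N ⊗[k] M →ₗ[A] ι →₀ N :=
  (TensorProduct.finsuppScalarRight k A N ι).toLinearMap ∘ₗ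
    TensorProduct.AlgebraTensorModule.map LinearMap.id f

theorem tensorCoord_apply {ι : Type*} [DecidableEq ι] (f : M →ₗ[k] ι →₀ k) (y : N ⊗[k] M) (i : ι) :
    tensorCoord A N f y i = tensorFunctional A N (Finsupp.lapply i ∘ₗ f) y := by
  induction y using TensorProduct.induction_on with
  | zero => simp
  | tmul n m => simp [tensorCoord, tensorFunctional_tmul]
  | add x y hx hy => simp only [map_add, Finsupp.add_apply, hx, hy]

/-- Dual basis formula: `N`-coordinates recover a tensor if `m = ∑ i, f_i(m) v_i` on `M`. -/
theorem sum_tensorCoord {ι : Type*} [DecidableEq ι] (f : M →ₗ[k] ι →₀ k) (v : ι → M)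
    (hf : ∀ m, Finsupp.linearCombination k v (f m) = m) (y : N ⊗[k] M) :
    (tensorCoord A N f y).sum (fun i n => n ⊗ₜ[k] v i) = y := by
  induction y using TensorProduct.induction_on with
  | zero => simp
  | tmul n m =>
    conv_rhs => rw [← hf m]
    rw [Finsupp.linearCombination_apply, Finsupp.sum.eq_1 (f m), TensorProduct.tmul_sum,
      Finsupp.sum_of_support_subset (s := (f m).support)]
    · refine Finset.sum_congr rfl fun i _ => ?_
      rw [tensorCoord_apply, tensorFunctional_tmul, TensorProduct.smul_tmul]
      rfl
    · intro i hi
      contrapose! hi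
      have h0 : f m i = 0 := by simpa using hi
      simp [tensorCoord_apply, tensorFunctional_tmul, h0]
    · simp
  | add x y hx hy =>
    rw [map_add, Finsupp.sum_add_index' (by simp) (by simp [TensorProduct.add_tmul]), hx, hy]

end Coordinates

/-! ### Colinear maps built from a section of the canonical map -/

section Principal

open BalTensor

variable {k : Type uk} {A : Type uA} {C : Type uC} {M : Type uM} [CommRing k] [Ring A] [Algebra k A]
  [AddCommGroup C] [Module k C] [Module A C] [Module Aᵐᵒᵖ C] [SMulCommClass A Aᵐᵒᵖ C]
  [IsScalarTower k A C] [IsScalarTower k Aᵐᵒᵖ C] {𝒞 : Coring k A C}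
  [AddCommGroup M] [Module k M] [Module Aᵐᵒᵖ M] [IsScalarTower k Aᵐᵒᵖ M]

/-- The maps `N ⊗_k V → N` given by functionals on `V` are left colinear, since the coaction of
`N ⊗_k V` only involves `N`. -/
theorem LeftComodule.tensorFunctional_mem {N V : Type*} [AddCommGroup N] [Module k N]
    [Module A N] [IsScalarTower k A N] [AddCommGroup V] [Module k V] (lam : LeftComodule 𝒞 N)
    (f : V →ₗ[k] k) : tensorFunctional A N f ∈ LeftComodule.Hom (lam.tensor V) lam := by
  intro y
  induction y using TensorProduct.induction_on with
  | zero => simp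
  | tmul n v =>
    have h1 : (lam.tensor V).coact (n ⊗ₜ[k] v) = BalTensor.map k LinearMap.id
      ((TensorProduct.AlgebraTensorModule.mk k A N V).flip v) (lam.coact n) := rfl
    have h2 : tensorFunctional A N f ∘ₗ (TensorProduct.AlgebraTensorModule.mk k A N V).flip v =
        f v • LinearMap.id := by
      ext n
      simp [tensorFunctional_tmul]
    rw [h1, map_map, h2, tensorFunctional_tmul, LinearMap.map_smul_of_tower, map_smul_right]
    exact congrArg _ (map_id_id _).symm
  | add x y hx hy => simp only [map_add, hx, hy]

namespace RightComodule

variable (ρ : RightComodule 𝒞 M)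

/-- A right colinear map `f : M → C` is determined by `ε ∘ f`. -/
theorem slice_counitR_comp (f : Hom ρ 𝒞.rightRegular) : ρ.slice (𝒞.counitR ∘ₗ f.1) = f.1 := by
  ext m
  change evalL (k := k) (𝒞.counitR ∘ₗ f.1) (ρ.coact m) = f.1 m
  rw [evalL_comp, ← f.2 m]
  exact 𝒞.counit_comul _

/-- The map `M* → Hom^𝒞(M, C)`, `ξ ↦ (m ↦ ξ(m₀) m₁)`. -/
noncomputable def sliceHom : (M →ₗ[Aᵐᵒᵖ] A) →ₗ[k] Hom ρ 𝒞.rightRegular where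
  toFun ξ := ⟨ρ.slice ξ, ρ.comul_slice ξ⟩
  map_add' ξ ξ' := Subtype.ext (ρ.slice_add ξ ξ')
  map_smul' c ξ := by
    ext m
    change ρ.slice (c • ξ) m = c • ρ.slice ξ m
    rw [← algebraMap_smul A c ξ, slice_smul, algebraMap_smul]

theorem sliceHom_surjective : Function.Surjective ρ.sliceHom := fun f =>
  ⟨𝒞.counitR ∘ₗ f.1, Subtype.ext (ρ.slice_counitR_comp f)⟩

theorem sliceHom_comp (ξ : M →ₗ[Aᵐᵒᵖ] A) (b : End ρ) :
    ρ.sliceHom (ξ ∘ₗ b.1) = op b • ρ.sliceHom ξ := by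
  ext m
  change evalL (k := k) (ξ ∘ₗ b.1) (ρ.coact m) = evalL (k := k) ξ (ρ.coact (b.1 m))
  have hb : b.1 ∈ Hom ρ ρ := b.2
  rw [evalL_comp, ← hb m]

/-- The map `M* ⊗_k M → Hom^𝒞(M, C) ⊗_B M`, `ξ ⊗ m ↦ ξ(-₀) -₁ ⊗ m`. -/
noncomputable def dualTensorToHomTensor :
    (M →ₗ[Aᵐᵒᵖ] A) ⊗[k] M →ₗ[k] BalTensor k (End ρ) (Hom ρ 𝒞.rightRegular) M :=
  TensorProduct.lift (LinearMap.mk₂ k (fun ξ m => tmul k (End ρ) (ρ.sliceHom ξ) m)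
    (fun ξ ξ' m => by rw [map_add, add_tmul])
    (fun c ξ m => by rw [map_smul, smul_tmul'])
    (fun ξ m m' => tmul_add _ _ _)
    (fun c ξ m => tmul_smul' _ _ _))

theorem dualTensorToHomTensor_tmul (ξ : M →ₗ[Aᵐᵒᵖ] A) (m : M) :
    ρ.dualTensorToHomTensor (ξ ⊗ₜ[k] m) = tmul k (End ρ) (ρ.sliceHom ξ) m := rfl

theorem evaluation_dualTensorToHomTensor (y : (M →ₗ[Aᵐᵒᵖ] A) ⊗[k] M) :
    (evaluation ρ 𝒞.rightRegular).1 (ρ.dualTensorToHomTensor y) = ρ.canMap y := by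
  induction y using TensorProduct.induction_on with
  | zero => simp
  | tmul ξ m => rfl
  | add x y hx hy => simp only [map_add, hx, hy]

theorem counit_canMap_sum {ι : Type*} (z : ι →₀ (M →ₗ[Aᵐᵒᵖ] A)) (v : ι → M) :
    𝒞.counit (ρ.canMap (z.sum fun i ξ => ξ ⊗ₜ[k] v i)) = z.sum fun i ξ => ξ (v i) := by
  rw [Finsupp.sum, map_sum, map_sum]
  exact Finset.sum_congr rfl fun i _ => ρ.counit_slice _ _

section Dual

variable [Module.Finite Aᵐᵒᵖ M] [Module.Projective Aᵐᵒᵖ M]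

/-- Left colinearity of `h : C → M*`, evaluated at `n ∈ M`: `c₁ h(c₂)(n) = h(c)(n₀) n₁`. -/
theorem evalR_comul_eq_slice (h : C →ₗ[A] M →ₗ[Aᵐᵒᵖ] A)
    (hh : h ∈ LeftComodule.Hom 𝒞.leftRegular ρ.dual) (c : C) (n : M) :
    evalR (k := k) (LinearMap.applyₗ' A n ∘ₗ h) (𝒞.comul c) = ρ.slice (h c) n := by
  have h1 (χ : (M →ₗ[Aᵐᵒᵖ] A) →ₗ[A] A) (x : BalTensor k A C C) :
      evalR (k := k) (χ ∘ₗ h) x = evalR (k := k) χ (BalTensor.map k LinearMap.id h x) := by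
    induction x using induction_on with
    | zero => simp
    | tmul c d => rfl
    | add x y hx hy => simp only [map_add, hx, hy]
  have h2 : BalTensor.map k LinearMap.id h (𝒞.comul c) = ∑ i, tmul k A
      (ρ.slice (h c) ((DualBasis.choose A M).e i)) ((DualBasis.choose A M).ξ i) := (hh c).symm
  rw [h1, h2, map_sum]
  conv_rhs => rw [← (DualBasis.choose A M).sum_eq n, map_sum]
  exact Finset.sum_congr rfl fun i _ => (map_smul _ _ _).symm

/-- For left colinear `h_i : C → M*`, each endomorphism `n ↦ m₀ h_i(m₁)(n)` of `M` is right
colinear: `(m₀ h_i(m₁)(n))₀ ⊗ (m₀ h_i(m₁)(n))₁ = m₀ ⊗ m₁ h_i(m₂)(n) = m₀ ⊗ h_i(m₁)(n₀) n₁`. -/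
theorem contract_coact_mem {ι : Type*} (h : C →ₗ[A] ι →₀ (M →ₗ[Aᵐᵒᵖ] A))
    (hh : ∀ i, Finsupp.lapply i ∘ₗ h ∈ LeftComodule.Hom 𝒞.leftRegular ρ.dual) (m : M) (i : ι) :
    contract h (ρ.coact m) i ∈ Hom ρ ρ := by
  intro n
  have h1 (χ : C →ₗ[A] A) (y : BalTensor k A (BalTensor k A M C) C) :
      evalR (k := k) χ y = BalTensor.map k LinearMap.id (evalRLeft k χ : _ →ₗ[A] C)
        (assoc k A A M C C y) := by
    induction y using induction_on with
    | zero => simp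
    | tmul x c =>
      induction x using induction_on with
      | zero => simp
      | tmul m d => rfl
      | add x y hx hy => simp only [add_tmul, map_add, hx, hy]
    | add x y hx hy => simp only [map_add, hx, hy]
  have h2 (g : C →ₗ[A] C) (y : BalTensor k A M C) (hg : ∀ c, g c = evalL (k := k) (h c i) y)
      (x : BalTensor k A M C) : BalTensor.map k LinearMap.id g x =
        BalTensor.map k (contract h x i) LinearMap.id y := by
    induction x using induction_on with
    | zero =>
      have h0 : (0 : M →ₗ[Aᵐᵒᵖ] M) = (0 : k) • 0 := by simp
      rw [map_zero, map_zero, Finsupp.zero_apply, h0, map_smul_left, zero_smul]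
    | tmul p c =>
      rw [contract_tmul, map_tmul, hg]
      exact tmul_evalL p (h c i) y
    | add x y hx hy => simp only [map_add, Finsupp.add_apply, map_add_left, hx, hy]
  rw [contract_apply, ← evalR_map, h1, ρ.coassoc, map_map]
  exact h2 _ _ (evalR_comul_eq_slice ρ _ (hh i) · n) _

/-- If `h_i : C → M*` are left colinear and `∑ i, h_i(c)(v_i) = ε(c)`, then `m ↦ (m₀ h_i(m₁)(-))_i`
is a `B`-linear section of `B^(ι) → M`, `(b_i) ↦ ∑ i, b_i(v_i)`: it is `B`-linear because `b m` has
coaction `b(m₀) ⊗ m₁`, and a section by `∑ i, m₀ h_i(m₁)(v_i) = m₀ ε(m₁) = m`. -/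
theorem projective_of_splitting {ι : Type*} (h : C →ₗ[A] ι →₀ (M →ₗ[Aᵐᵒᵖ] A))
    (hh : ∀ i, Finsupp.lapply i ∘ₗ h ∈ LeftComodule.Hom 𝒞.leftRegular ρ.dual) (v : ι → M)
    (hv : ∀ c, (h c).sum (fun i ξ => ξ (v i)) = 𝒞.counit c) : Module.Projective (End ρ) M := by
  let σ : M →ₗ[End ρ] ι →₀ End ρ :=
    { toFun := fun m => Finsupp.onFinset (contract h (ρ.coact m)).support
        (fun i => ⟨contract h (ρ.coact m) i, ρ.contract_coact_mem h hh m i⟩)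
        (fun i hi => by
          rw [Finsupp.mem_support_iff]
          exact fun h0 => hi (Subtype.ext h0))
      map_add' := fun m m' => by
        ext i x
        simp
      map_smul' := fun b m => by
        have hb : b.1 ∈ Hom ρ ρ := b.2
        ext i x
        change contract h (ρ.coact (b.1 m)) i x = b.1 (contract h (ρ.coact m) i x)
        rw [hb m, contract_map, LinearMap.comp_apply] }
  refine Module.Projective.of_split σ (Finsupp.linearCombination (End ρ) v) ?_
  ext m
  have hs : (σ m).support ⊆ (contract h (ρ.coact m)).support := by
    intro i hi
    contrapose! hi
    rw [Finsupp.notMem_support_iff] at hi ⊢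
    exact Subtype.ext hi
  rw [LinearMap.comp_apply, Finsupp.linearCombination_apply, Finsupp.sum_of_support_subset _ hs _
    (by simp)]
  exact (contract_sum h v 𝒞.counit hv _).trans (ρ.coact_counit m)

/-- Write `s(c) = ∑ i, h_i(c) ⊗ v_i` and `b_i = m₀ h_i(m₁)(-) ∈ B`. Then `h_i(ξ(m₀) m₁) = ξ ∘ b_i`, so
the class of `s(ξ(m₀) m₁)` in `Hom^𝒞(M, C) ⊗_B M ≅ M* ⊗_B M` is
`∑ i, ξ ∘ b_i ⊗ v_i = ξ ⊗ ∑ i, b_i(v_i) = ξ ⊗ m`. -/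
theorem dualTensorToHomTensor_slice {ι : Type*} (h : C →ₗ[A] ι →₀ (M →ₗ[Aᵐᵒᵖ] A))
    (hh : ∀ i, Finsupp.lapply i ∘ₗ h ∈ LeftComodule.Hom 𝒞.leftRegular ρ.dual) (v : ι → M)
    (hv : ∀ c, (h c).sum (fun i ξ => ξ (v i)) = 𝒞.counit c) (ξ : M →ₗ[Aᵐᵒᵖ] A) (m : M) :
    ρ.dualTensorToHomTensor ((h (ρ.slice ξ m)).sum fun i η => η ⊗ₜ[k] v i) =
      tmul k (End ρ) (ρ.sliceHom ξ) m := by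
  have h1 (x : BalTensor k A M C) (i : ι) :
      h (evalL (k := k) ξ x) i = ξ ∘ₗ contract h x i := by
    induction x using induction_on with
    | zero => simp
    | tmul p c =>
      ext n
      simp [contract_tmul, rankOne_apply]
    | add x y hx hy => simp only [map_add, Finsupp.add_apply, LinearMap.comp_add, hx, hy]
  have h2 (i : ι) : h (ρ.slice ξ m) i = ξ ∘ₗ contract h (ρ.coact m) i := h1 _ i
  have hs : (h (ρ.slice ξ m)).support ⊆ (contract h (ρ.coact m)).support := fun i hi => by
    contrapose! hi
    have h0 : contract h (ρ.coact m) i = 0 := by simpa using hi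
    rw [Finsupp.notMem_support_iff, h2, h0, LinearMap.comp_zero]
  have h3 (i : ι) : ρ.dualTensorToHomTensor (h (ρ.slice ξ m) i ⊗ₜ[k] v i) =
      (tmulL k (End ρ) (ρ.sliceHom ξ) : M →ₗ[Aᵐᵒᵖ] _) (contract h (ρ.coact m) i (v i)) := by
    rw [h2, dualTensorToHomTensor_tmul,
      ρ.sliceHom_comp ξ ⟨_, ρ.contract_coact_mem h hh m i⟩, op_smul_tmul]
    rfl
  rw [Finsupp.sum_of_support_subset _ hs _ (by simp), map_sum, Finset.sum_congr rfl fun i _ => h3 i,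
    ← map_sum]
  exact congrArg (tmul k (End ρ) (ρ.sliceHom ξ))
    ((contract_sum h v 𝒞.counit hv _).trans (ρ.coact_counit m))

end Dual

/-- The inverse of a bijective colinear map is colinear. -/
theorem isIso_of_bijective {N : Type*} [AddCommGroup N] [Module k N] [Module Aᵐᵒᵖ N]
    [IsScalarTower k Aᵐᵒᵖ N] {σ : RightComodule 𝒞 N} (f : Hom ρ σ)
    (hf : Function.Bijective f.1) : IsIso ρ σ f := by
  let e := LinearEquiv.ofBijective f.1 hf
  have h1 : e.symm.toLinearMap ∘ₗ f.1 = LinearMap.id := LinearMap.ext e.symm_apply_apply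
  have h2 : f.1 ∘ₗ e.symm.toLinearMap = LinearMap.id := LinearMap.ext e.apply_symm_apply
  refine ⟨⟨e.symm.toLinearMap, fun n => ?_⟩, h1, h2⟩
  obtain ⟨m, rfl⟩ := hf.2 n
  have h3 : e.symm.toLinearMap (f.1 m) = m := e.symm_apply_apply m
  rw [h3, f.2 m, map_map, h1, LinearMap.comp_id, map_id_id]

end RightComodule

end Principal

theorem corollary2p2 {k : Type uk} {A : Type uA} {C : Type uC} {M : Type uM}
    [CommRing k] [Ring A] [Algebra k A]
    [AddCommGroup C] [Module k C] [Module A C] [Module Aᵐᵒᵖ C] [SMulCommClass A Aᵐᵒᵖ C]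
    [IsScalarTower k A C] [IsScalarTower k Aᵐᵒᵖ C] (𝒞 : Coring k A C)
    [AddCommGroup M] [Module k M] [Module Aᵐᵒᵖ M] [IsScalarTower k Aᵐᵒᵖ M]
    (ρ : RightComodule 𝒞 M) [Module.Finite Aᵐᵒᵖ M] [Module.Projective Aᵐᵒᵖ M]
    (ha : IsFlatLeftModule k A C) (hb : Module.Projective k M)
    (hc : LeftComodule.IsSplitEpi (ρ.dual.tensor M) 𝒞.leftRegular ρ.can) :
    ρ.IsPrincipal := by
  classical
  -- `k`-linear coordinates on `M`, indexed by `M` itself, so that `v = id` in the lemmas above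
  obtain ⟨f, hf⟩ := Module.projective_def'.1 hb
  obtain ⟨s, hs⟩ := hc
  have hs' (c : C) : ρ.canMap (s.1 c) = c := LinearMap.congr_fun hs c
  let h : C →ₗ[A] M →₀ (M →ₗ[Aᵐᵒᵖ] A) := tensorCoord A (M →ₗ[Aᵐᵒᵖ] A) f ∘ₗ s.1
  have hsum (c : C) : (h c).sum (fun i ξ => ξ ⊗ₜ[k] i) = s.1 c :=
    sum_tensorCoord f id (LinearMap.congr_fun hf) (s.1 c)
  have hh (i : M) : Finsupp.lapply i ∘ₗ h ∈ LeftComodule.Hom 𝒞.leftRegular ρ.dual := by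
    have hi : Finsupp.lapply i ∘ₗ h =
        tensorFunctional A (M →ₗ[Aᵐᵒᵖ] A) (Finsupp.lapply i ∘ₗ f) ∘ₗ s.1 :=
      LinearMap.ext fun c => tensorCoord_apply f (s.1 c) i
    intro c
    have h1 := ρ.dual.tensorFunctional_mem (Finsupp.lapply i ∘ₗ f) (s.1 c)
    rw [hi, LinearMap.comp_apply, h1, s.2 c, BalTensor.map_map]
    rfl
  have hv (c : C) : (h c).sum (fun i ξ => ξ (id i)) = 𝒞.counit c := by
    rw [← ρ.counit_canMap_sum]
    exact congrArg 𝒞.counit ((congrArg ρ.canMap (hsum c)).trans (hs' c))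
  refine ⟨⟨inferInstance, inferInstance, RightComodule.isIso_of_bijective _ _ ?_⟩,
    ρ.projective_of_splitting h hh id hv⟩
  refine Function.bijective_iff_has_inverse.2
    ⟨fun c => ρ.dualTensorToHomTensor (s.1 c), fun y => ?_, fun c => ?_⟩
  · change ρ.dualTensorToHomTensor (s.1 ((RightComodule.evaluation ρ 𝒞.rightRegular).1 y)) = y
    induction y using BalTensor.induction_on with
    | zero => simp
    | tmul g m =>
      obtain ⟨ξ, rfl⟩ := ρ.sliceHom_surjective g
      rw [← hsum]
      exact ρ.dualTensorToHomTensor_slice h hh id hv ξ m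
    | add x y hx hy => simp only [map_add, hx, hy]
  · exact (ρ.evaluation_dualTensorToHomTensor _).trans (hs' c)
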